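/- Let $(R,\mathfrak m,k)$ be a commutative Noetherian local ring, and let all modules be finitely generated. For a sequence $\{a_n\}$ of non-negative real numbers, let $\operatorname{cx}\{a_n\}$ be the smallest integer $b\ge 0$ such that, for some constant $\alpha>0$, $a_n\le\alpha n^{b-1}$ for all $n\gg 0$ (and $\infty$ if there is no such $b$), and let $\operatorname{curv}\{a_n\}=\limsup_{n\to\infty}\sqrt[n]{a_n}\in[0,\infty]$. Write $\mu_R(-)$ for the minimal number of generators. For $R$-modules $M,N$ put $$\operatorname{cx}_R(N)=\operatorname{cx}\{\operatorname{rank}_k\operatorname{Ext}^n_R(N,k)\},\quad \operatorname{injcx}_R(N)=\operatorname{cx}\{\operatorname{rank}_k\operatorname{Ext}^n_R(k,N)\},$$ $$\operatorname{cx}_R(M,N)=\operatorname{cx}\{\mu_R(\operatorname{Ext}_R^n(M,N))\},\quad \operatorname{tcx}_R(M,N)=\operatorname{cx}\{\mu_R(\operatorname{Tor}^R_n(M,N))\},$$ and let $\operatorname{curv}_R(N)$, $\operatorname{injcurv}_R(N)$, $\operatorname{curv}_R(M,N)$, $\operatorname{tcurv}_R(M,N)$ be the curvatures of the same four sequences,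 respectively. A submodule $M$ of an $R$-module $X$ is called Burch if $\mathfrak m(M:_X\mathfrak m)\ne\mathfrak m M$, where $(M:_X\mathfrak m)=\{x\in X:\mathfrak m x\subseteq M\}$. With $(-)^*=\operatorname{Hom}_R(-,R)$, a module $X$ is called torsionless if the canonical map $X\to X^{**}$ is injective, and totally reflexive if that map is bijective and $\operatorname{Ext}^i_R(X,R)=0=\operatorname{Ext}^i_R(X^*,R)$ for all $i\ge 1$; $X$ has finite G-dimension if there is an exact sequence $0\to G_n\to\cdots\to G_0\to X\to 0$ with all $G_i$ totally reflexive. **Theorem.** Let $M$ and $N$ be $R$-modules such that $M$ is a Burch submodule of some $R$-module $X$. Assume that $X$ has finite G-dimension or that $X$ is torsionless. 1. If there is an $h>0$ such that $\mathfrak m^h\operatorname{Tor}^R_n(M,N)=0$ for all $n\gg 0$, then $\operatorname{cx}_R(N)\le\operatorname{tcx}_R(M,N)$ and $\operatorname{curv}_R(N)\le\operatorname{tcurv}_R(M,N)$. 2. If there is an $h>0$ such that $\mathfrak m^h\operatorname{Ext}_R^n(M,N)=0$ for all $n\gg 0$, then $\operatorname{injcx}_R(N)\le\operatorname{cx}_R(M,N)$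 and $\operatorname{injcurv}_R(N)\le\operatorname{curv}_R(M,N)$. -/

import Mathlib

universe u

open CategoryTheory IsLocalRing Filter

noncomputable section

namespace BurchGrowth

/-! ### Growth of sequences -/

/-- The complexity of a sequence of non-negative reals: the smallest integer `b ≥ 0` such that
`a n ≤ α n ^ (b - 1)` for all large `n` and some constant `α > 0`, and `∞` if there is none. -/
def cxSeq (a : ℕ → ℝ) : ℕ∞ :=
  ⨅ (b : ℕ) (_ : ∃ α : ℝ, 0 < α ∧ ∀ᶠ n : ℕ in atTop, a n ≤ α * (n : ℝ) ^ ((b : ℤ) - 1)), (b : ℕ∞)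

/-- The curvature of a sequence of non-negative reals: `limsup` of the `n`-th roots,
as an element of `[0, ∞]`. -/
def curvSeq (a : ℕ → ℝ) : ENNReal :=
  limsup (fun n : ℕ => ENNReal.ofReal (a n ^ (1 / (n : ℝ)))) atTop

section Modules

variable (R : Type u) [CommRing R]

/-! ### Tor, Ext and numbers of generators -/

/-- The `R`-module `Tor_n^R(M, N)`. -/
abbrev TorMod (n : ℕ) (M N : Type u) [AddCommGroup M] [Module R M] [AddCommGroup N]
    [Module R N] : Type u :=
  ((((Tor (ModuleCat.{u} R) n).obj (ModuleCat.of R M)).obj (ModuleCat.of R N) : ModuleCat.{u} R) :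
    Type u)

/-- The `R`-module `Ext^n_R(M, N)`. -/
abbrev ExtMod (n : ℕ) (M N : Type u) [AddCommGroup M] [Module R M] [AddCommGroup N]
    [Module R N] : Type u :=
  Abelian.Ext (ModuleCat.of R M) (ModuleCat.of R N) n

/-- The minimal number of generators of a (finitely generated) module. -/
def numGen (M : Type u) [AddCommGroup M] [Module R M] : ℕ :=
  (⊤ : Submodule R M).spanFinrank

/-! ### Complexity and curvature of a pair of modules -/

section Pairs

variable (M N : Type u) [AddCommGroup M] [Module R M] [AddCommGroup N] [Module R N]

/-- The Ext-complexity `cx_R(M, N)`. -/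
def cxPair : ℕ∞ := cxSeq fun n => (numGen R (ExtMod R n M N) : ℝ)

/-- The Ext-curvature `curv_R(M, N)`. -/
def curvPair : ENNReal := curvSeq fun n => (numGen R (ExtMod R n M N) : ℝ)

/-- The Tor-complexity `tcx_R(M, N)`. -/
def tcx : ℕ∞ := cxSeq fun n => (numGen R (TorMod R n M N) : ℝ)

/-- The Tor-curvature `tcurv_R(M, N)`. -/
def tcurv : ENNReal := curvSeq fun n => (numGen R (TorMod R n M N) : ℝ)

end Pairs

/-! ### Torsionless modules and Gorenstein dimension -/

section GDim

/-- `X` is torsionless: the canonical map to the double dual is injective. -/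
def IsTorsionless (X : Type u) [AddCommGroup X] [Module R X] : Prop :=
  Function.Injective (Module.Dual.eval R X)

/-- `X` is totally reflexive, that is, a finitely generated module of Gorenstein dimension zero:
`X` is reflexive and `Ext^i(X, R) = 0 = Ext^i(X*, R)` for all `i ≥ 1`. -/
structure IsTotallyReflexive (X : Type u) [AddCommGroup X] [Module R X] : Prop where
  finite : Module.Finite R X
  reflexive : Module.IsReflexive R X
  ext_self : ∀ i : ℕ, 1 ≤ i → Subsingleton (ExtMod R i X R)
  ext_dual : ∀ i : ℕ, 1 ≤ i → Subsingleton (ExtMod R i (Module.Dual R X) R)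

/-- There is an exact sequence `0 → G_n → ⋯ → G_0 → X → 0` with all `G_i` totally reflexive
(some of them possibly zero). -/
def GDimLE : ℕ → ∀ (X : Type u) [AddCommGroup X] [Module R X], Prop
  | 0, X, _, _ => IsTotallyReflexive R X
  | n + 1, X, _, _ => ∃ (K G : ModuleCat.{u} R) (i : K →ₗ[R] G) (p : G →ₗ[R] X),
      IsTotallyReflexive R G ∧ Function.Injective i ∧ Function.Exact i p ∧
        Function.Surjective p ∧ GDimLE n K

/-- The Gorenstein dimension of `X` (with the value `0` for the zero module). -/
def gDim (X : Type u) [AddCommGroup X] [Module R X] : ℕ∞ :=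
  ⨅ (n : ℕ) (_ : GDimLE R n X), (n : ℕ∞)

end GDim

/-! ### Betti and Bass numbers; complexities and curvatures of a module -/

section Local

variable [IsLocalRing R]

lemma smul_id_residueField {r : R} (hr : r ∈ maximalIdeal R) :
    r • 𝟙 (ModuleCat.of R (ResidueField R)) = 0 := by
  refine ModuleCat.hom_ext (LinearMap.ext fun x => ?_)
  change r • (x : ResidueField R) = 0
  rw [Algebra.smul_def]
  exact mul_eq_zero_of_left ((residue_eq_zero_iff r).2 hr) x

lemma ext_residueField_torsion (n : ℕ) (M : Type u) [AddCommGroup M] [Module R M] :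
    Module.IsTorsionBySet R (ExtMod R n M (ResidueField R)) (maximalIdeal R : Set R) := by
  rintro x ⟨r, hr⟩
  change r • x = 0
  rw [Abelian.Ext.smul_eq_comp_mk₀, smul_id_residueField R hr, Abelian.Ext.mk₀_zero,
    Abelian.Ext.comp_zero]

lemma ext_from_residueField_torsion (n : ℕ) (M : Type u) [AddCommGroup M] [Module R M] :
    Module.IsTorsionBySet R (ExtMod R n (ResidueField R) M) (maximalIdeal R : Set R) := by
  rintro x ⟨r, hr⟩
  change r • x = 0
  rw [← Abelian.Ext.mk₀_id_comp x, ← Abelian.Ext.smul_comp, ← Abelian.Ext.mk₀_smul,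
    smul_id_residueField R hr, Abelian.Ext.mk₀_zero, Abelian.Ext.zero_comp]

variable (M : Type u) [AddCommGroup M] [Module R M]

/-- The `n`-th Betti number `rank_k Ext^n_R(M, k)`, where `k = R ⧸ 𝔪` acts on `Ext^n_R(M, k)`
because `𝔪` annihilates it. -/
def betti (n : ℕ) : ℕ :=
  letI : Module (R ⧸ maximalIdeal R) (ExtMod R n M (ResidueField R)) :=
    (ext_residueField_torsion R n M).module
  Module.finrank (R ⧸ maximalIdeal R) (ExtMod R n M (ResidueField R))

/-- The `n`-th Bass number `rank_k Ext^n_R(k, M)`. -/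
def bass (n : ℕ) : ℕ :=
  letI : Module (R ⧸ maximalIdeal R) (ExtMod R n (ResidueField R) M) :=
    (ext_from_residueField_torsion R n M).module
  Module.finrank (R ⧸ maximalIdeal R) (ExtMod R n (ResidueField R) M)

/-- The complexity `cx_R(M)`. -/
def cx : ℕ∞ := cxSeq fun n => (betti R M n : ℝ)

/-- The curvature `curv_R(M)`. -/
def curv : ENNReal := curvSeq fun n => (betti R M n : ℝ)

/-- The injective complexity `injcx_R(M)`. -/
def injcx : ℕ∞ := cxSeq fun n => (bass R M n : ℝ)

/-- The injective curvature `injcurv_R(M)`. -/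
def injcurv : ENNReal := curvSeq fun n => (bass R M n : ℝ)

end Local

end Modules

/-! ### Burch submodules -/

section Burch

variable {R : Type u} [CommRing R] {X : Type u} [AddCommGroup X] [Module R X]

/-- The submodule `(M :_X I) = {x ∈ X | I x ⊆ M}` of `X`. -/
def colonIn (M : Submodule R X) (I : Ideal R) : Submodule R X where
  carrier := {x | ∀ r ∈ I, r • x ∈ M}
  zero_mem' := fun r _ => by simp
  add_mem' := fun hx hy r hr => by
    rw [smul_add]
    exact M.add_mem (hx r hr) (hy r hr)
  smul_mem' := fun c x hx r hr => by
    rw [smul_comm]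
    exact M.smul_mem c (hx r hr)

/-- `M` is a Burch submodule of `X`: `𝔪 (M :_X 𝔪) ≠ 𝔪 M`. -/
def IsBurch [IsLocalRing R] (M : Submodule R X) : Prop :=
  maximalIdeal R • colonIn M (maximalIdeal R) ≠ maximalIdeal R • M

end Burch

end BurchGrowth

end

open BurchGrowth

open MonoidalCategory

/-! The Burch condition gives `r ∈ 𝔪` and `x ∈ X` with `𝔪 x ⊆ M` and `r x ∉ 𝔪 M`. Put `M' = M + R
x`, so that `M' / M ≅ k`. Multiplication by `r` maps `M'` into `M`, and a functional `p : M → k`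
with `p (r x) = 1` turns it into the quotient map `M' → k`. So in the sequence `0 → M → M' → k → 0`
the surjection factors through `M` (`IsBurch.exists_factorization`).

Hence the image of `Tor_{n+1}(M', N)` in `Tor_{n+1}(k, N)` lies in the image of `Tor_{n+1}(M, N)`,
and what remains embeds in `Tor_n(M, N)` by the connecting map. Thus `length Tor_{n+1}(k, N)`, and
with it the Betti number of `N`, is at most the sum of the lengths of two consecutive `Tor(M, N)`;
dually for `Ext` and Bass numbers. When `𝔪 ^ h` kills these modules, length is at most `length (R ⧸
𝔪 ^ h)` times the number of generators, and neither a constant factor nor a shift of index raises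
complexity or curvature. -/

namespace BurchGrowth

/-! ### Complexity and curvature under domination by consecutive terms. -/

section Growth

/-- `b` is eventually dominated by a constant multiple of the sum of two consecutive terms
of `a`. -/
def DominatedByConsecutive (b a : ℕ → ℝ) : Prop :=
  ∃ C : ℝ, 0 < C ∧ ∀ᶠ n in atTop, b (n + 1) ≤ C * (a (n + 1) + a n)

/-- The factor `2` serves only `b = 0`, where the power is decreasing and `n + 1 ≤ 2 n` is needed.
-/
lemma zpow_le_two_mul_zpow_succ (b n : ℕ) (hn : 1 ≤ n) :
    (n : ℝ) ^ ((b : ℤ) - 1) ≤ 2 * ((n + 1 : ℕ) : ℝ) ^ ((b : ℤ) - 1) := by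
  have hn' : (1 : ℝ) ≤ n := by exact_mod_cast hn
  rcases b with _ | b
  · simp only [Nat.cast_zero, zero_sub, zpow_neg, zpow_one, Nat.cast_add, Nat.cast_one]
    rw [← div_eq_mul_inv, inv_eq_one_div, div_le_div_iff₀ (by positivity) (by positivity)]
    linarith
  · simp only [Nat.cast_add, Nat.cast_one, add_sub_cancel_right, zpow_natCast]
    have h : (n : ℝ) ^ b ≤ ((n : ℝ) + 1) ^ b := pow_le_pow_left₀ (by linarith) (by linarith) b
    have : 0 ≤ ((n : ℝ) + 1) ^ b := by positivity
    linarith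

lemma cxSeq_le_of_dominated {a b : ℕ → ℝ} (h : DominatedByConsecutive b a) :
    cxSeq b ≤ cxSeq a := by
  obtain ⟨C, hC, hev⟩ := h
  -- `3 α = α + 2 α`: the term of index `n + 1` costs `α`, the one of index `n` costs `2 α`.
  refine le_iInf₂ fun e ⟨α, hα, ha⟩ => iInf₂_le e ⟨C * (3 * α), by positivity, ?_⟩
  have key : ∀ᶠ n : ℕ in atTop,
      b (n + 1) ≤ C * (3 * α) * ((n + 1 : ℕ) : ℝ) ^ ((e : ℤ) - 1) := by
    filter_upwards [hev, ha, (tendsto_add_atTop_nat 1).eventually ha, eventually_ge_atTop 1]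
      with n h₁ h₂ h₃ h₄
    have h₅ := mul_le_mul_of_nonneg_left (zpow_le_two_mul_zpow_succ e n h₄) hα.le
    calc b (n + 1) ≤ C * (a (n + 1) + a n) := h₁
      _ ≤ C * (3 * α * ((n + 1 : ℕ) : ℝ) ^ ((e : ℤ) - 1)) := by gcongr; linarith
      _ = _ := by ring
  obtain ⟨n₀, hn₀⟩ := eventually_atTop.1 key
  refine eventually_atTop.2 ⟨n₀ + 1, fun n hn => ?_⟩
  obtain ⟨m, rfl⟩ : ∃ m, n = m + 1 := ⟨n - 1, by omega⟩
  exact hn₀ m (by omega)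

/-- For every finite `c > curvSeq a`, eventually `a n ≤ c ^ n`, hence `b n ≤ D c ^ n` with `D`
constant, and the `n`-th root of `D` tends to `1`. -/
lemma curvSeq_le_of_dominated {a b : ℕ → ℝ} (ha : ∀ n, 0 ≤ a n) (hb : ∀ n, 0 ≤ b n)
    (h : DominatedByConsecutive b a) : curvSeq b ≤ curvSeq a := by
  obtain ⟨C, hC, hev⟩ := h
  refine le_of_forall_gt fun t ht => ?_
  obtain ⟨c, hac, hct⟩ := exists_between ht
  refine lt_of_le_of_lt ?_ hct
  have hc_top : c ≠ ⊤ := (hct.trans_le le_top).ne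
  lift c to NNReal using hc_top
  have hc : 0 < (c : ℝ) := by
    have : (0 : ENNReal) < c := lt_of_le_of_lt zero_le hac
    exact_mod_cast this
  have ha' : ∀ᶠ n : ℕ in atTop, a n ≤ (c : ℝ) ^ n := by
    filter_upwards [eventually_lt_of_limsup_lt hac, eventually_ge_atTop 1] with n hn hn1
    have h₁ : a n ^ (1 / (n : ℝ)) ≤ c := by
      have := hn.le
      rw [← ENNReal.ofReal_coe_nnreal] at this
      exact (ENNReal.ofReal_le_ofReal_iff c.2).1 this
    have h₂ := pow_le_pow_left₀ (Real.rpow_nonneg (ha n) _) h₁ n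
    rwa [one_div, Real.rpow_inv_natCast_pow (ha n) (by omega)] at h₂
  set D : ℝ := C * (1 + 1 / c) with hD
  have hDpos : 0 < D := by positivity
  have hb' : ∀ᶠ n : ℕ in atTop, b n ≤ D * (c : ℝ) ^ n := by
    have key : ∀ᶠ n : ℕ in atTop, b (n + 1) ≤ D * (c : ℝ) ^ (n + 1) := by
      filter_upwards [hev, ha', (tendsto_add_atTop_nat 1).eventually ha'] with n h₁ h₂ h₃
      calc b (n + 1) ≤ C * (a (n + 1) + a n) := h₁
        _ ≤ C * ((c : ℝ) ^ (n + 1) + (c : ℝ) ^ n) := by gcongr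
        _ = _ := by rw [hD, pow_succ]; field_simp
    obtain ⟨n₀, hn₀⟩ := eventually_atTop.1 key
    refine eventually_atTop.2 ⟨n₀ + 1, fun n hn => ?_⟩
    obtain ⟨m, rfl⟩ : ∃ m, n = m + 1 := ⟨n - 1, by omega⟩
    exact hn₀ m (by omega)
  have hlim : Tendsto (fun n : ℕ => ENNReal.ofReal (D ^ (1 / (n : ℝ)) * c)) atTop
      (nhds (c : ENNReal)) := by
    rw [← ENNReal.ofReal_coe_nnreal]
    refine ENNReal.tendsto_ofReal ?_
    have h₁ : Tendsto (fun n : ℕ => D ^ (1 / (n : ℝ))) atTop (nhds (D ^ (0 : ℝ))) :=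
      (Real.continuous_const_rpow hDpos.ne').continuousAt.tendsto.comp
        tendsto_one_div_atTop_nhds_zero_nat
    simpa using h₁.mul_const (c : ℝ)
  rw [← hlim.limsup_eq]
  refine limsup_le_limsup ?_
  filter_upwards [hb', eventually_ge_atTop 1] with n hn hn1
  refine ENNReal.ofReal_le_ofReal ?_
  calc b n ^ (1 / (n : ℝ)) ≤ (D * (c : ℝ) ^ n) ^ (1 / (n : ℝ)) :=
        Real.rpow_le_rpow (hb n) hn (by positivity)
    _ = D ^ (1 / (n : ℝ)) * c := by
        rw [Real.mul_rpow hDpos.le (by positivity), one_div,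
          Real.pow_rpow_inv_natCast hc.le (by omega)]

end Growth

/-! ### Comparing length, number of generators and dimension over `k`. -/

section Length

variable {R : Type u} [CommRing R]

/-- A finitely generated module annihilated by `I` has length at most
`μ(T) · length (R ⧸ I)`. -/
lemma length_le_numGen_mul (I : Ideal R) (T : Type u) [AddCommGroup T] [Module R T]
    [Module.Finite R T] (hT : I • (⊤ : Submodule R T) = ⊥) :
    Module.length R T ≤ numGen R T * Module.length R (R ⧸ I) := by
  classical
  obtain ⟨s, hcard, hspan⟩ :=
    (Module.Finite.fg_top (R := R) (M := T)).exists_span_finset_card_eq_spanFinrank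
  have hkill (t : T) : I ≤ LinearMap.ker (LinearMap.toSpanSingleton R T t) := fun r hr => by
    have : r • t ∈ I • (⊤ : Submodule R T) := Submodule.smul_mem_smul hr trivial
    rw [hT] at this
    simpa using this
  let g : (s → R ⧸ I) →ₗ[R] T :=
    LinearMap.lsum R (fun _ => R ⧸ I) R fun t => Submodule.liftQ I _ (hkill t)
  have hg : Function.Surjective g := fun t => by
    have ht : t ∈ Submodule.span R (Set.range ((↑) : s → T)) := by
      simp [hspan]
    obtain ⟨c, rfl⟩ := (Submodule.mem_span_range_iff_exists_fun R).1 ht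
    exact ⟨fun i => Submodule.Quotient.mk (c i), by simp [g]; rfl⟩
  refine (Module.length_le_of_surjective g hg).trans ?_
  rw [Module.length_pi, ENat.card_eq_coe_fintype_card, Fintype.card_coe, hcard]
  rfl

lemma length_quotient_maximalIdeal_pow_ne_top [IsLocalRing R] [IsNoetherianRing R] (h : ℕ) :
    Module.length R (R ⧸ maximalIdeal R ^ h) ≠ ⊤ := by
  -- For `h = 0` the quotient is the zero ring, which is not local. Otherwise it is a Noetherian
  -- local ring with nilpotent maximal ideal, hence Artinian.
  by_cases hI : maximalIdeal R ^ h = ⊤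
  · have : Subsingleton (R ⧸ maximalIdeal R ^ h) := Ideal.Quotient.subsingleton_iff.2 hI
    simp
  have : Nontrivial (R ⧸ maximalIdeal R ^ h) := Ideal.Quotient.nontrivial_iff.mpr hI
  have := IsLocalRing.of_surjective' (Ideal.Quotient.mk (maximalIdeal R ^ h))
    Ideal.Quotient.mk_surjective
  have hmap : (maximalIdeal R).map (Ideal.Quotient.mk (maximalIdeal R ^ h)) =
      maximalIdeal (R ⧸ maximalIdeal R ^ h) := by
    have := IsLocalHom.of_surjective (Ideal.Quotient.mk (maximalIdeal R ^ h))
      Ideal.Quotient.mk_surjective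
    ext x
    obtain ⟨x, rfl⟩ := Ideal.Quotient.mk_surjective x
    simp [sup_eq_left.mpr (le_maximalIdeal hI)]
  have : IsArtinianRing (R ⧸ maximalIdeal R ^ h) := by
    rw [isArtinianRing_iff_isNilpotent_maximalIdeal, ← hmap]
    exact ⟨h, by rw [← Ideal.map_pow, Ideal.map_quotient_self]; rfl⟩
  rw [Module.length_eq_of_surjective (R := R ⧸ maximalIdeal R ^ h)
    (S := R) Ideal.Quotient.mk_surjective]
  exact Module.length_ne_top

/-- A subquotient comparison: if `α` is onto and vanishes on `ker β`, the target of `α` is no longer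
than the target of `β`. -/
lemma length_le_of_ker_le {Z E H : Type*} [AddCommGroup Z] [Module R Z] [AddCommGroup E]
    [Module R E] [AddCommGroup H] [Module R H] (α : Z →ₗ[R] E) (β : Z →ₗ[R] H)
    (hα : Function.Surjective α) (h : ∀ z, β z = 0 → α z = 0) :
    Module.length R E ≤ Module.length R H := by
  have h' : LinearMap.ker β ≤ LinearMap.ker α := h
  refine (Module.length_le_of_surjective ((LinearMap.ker β).liftQ α h') fun e => ?_).trans
    (Module.length_le_of_injective ((LinearMap.ker β).liftQ β le_rfl)
      (LinearMap.ker_eq_bot.1 (Submodule.ker_liftQ_eq_bot _ _ _ le_rfl)))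
  obtain ⟨z, rfl⟩ := hα e
  exact ⟨Submodule.Quotient.mk z, by simp⟩

/-- If `ker δ` lies in the range of `f`, then `length T ≤ length A + length B`. -/
lemma length_le_add_of_ker_le_range {A B T : Type*} [AddCommGroup A] [Module R A]
    [AddCommGroup B] [Module R B] [AddCommGroup T] [Module R T] (f : A →ₗ[R] T) (δ : T →ₗ[R] B)
    (h : LinearMap.ker δ ≤ LinearMap.range f) :
    Module.length R T ≤ Module.length R A + Module.length R B := by
  rw [Module.length_eq_add_of_exact (LinearMap.ker δ).subtype δ.rangeRestrict
    (Submodule.subtype_injective _) δ.surjective_rangeRestrict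
    (by rw [LinearMap.exact_iff, LinearMap.ker_rangeRestrict, Submodule.range_subtype])]
  gcongr
  · exact (Module.length_le_of_injective _ (Submodule.inclusion_injective h)).trans
      (Module.length_le_of_surjective _ f.surjective_rangeRestrict)
  · exact Module.length_le_of_injective _ (Submodule.subtype_injective _)

variable [IsLocalRing R]

/-- The vector space dimension of a module annihilated by the maximal ideal is bounded
by its length. -/
lemma finrank_le_length {T : Type u} [AddCommGroup T] [Module R T]
    (hT : Module.IsTorsionBySet R T (maximalIdeal R : Set R)) :
    letI : Module (R ⧸ maximalIdeal R) T := hT.module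
    (Module.finrank (R ⧸ maximalIdeal R) T : ℕ∞) ≤ Module.length R T := by
  let : Module (R ⧸ maximalIdeal R) T := hT.module
  let : Field (R ⧸ maximalIdeal R) := Ideal.Quotient.field _
  have : IsScalarTower R (R ⧸ maximalIdeal R) T := hT.isScalarTower
  rw [Module.length_eq_of_surjective (R := R ⧸ maximalIdeal R) (S := R)
    Ideal.Quotient.mk_surjective]
  by_cases hfin : Module.Finite (R ⧸ maximalIdeal R) T
  · exact (Module.length_eq_finrank (R ⧸ maximalIdeal R) T).ge
  -- In infinite dimension `finrank` is `0` by convention.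
  · simp [Module.finrank_of_not_finite hfin]

end Length

/-! ### The factorization attached to a Burch submodule. -/

section Burch

variable {R : Type u} [CommRing R] [IsLocalRing R]

/-- The class of `y` is a nonzero vector of the `k`-space `M / 𝔪 M`, so some functional takes the
value `1` on it. -/
lemma exists_linearMap_residueField_eq_one {M : Type u} [AddCommGroup M] [Module R M] {y : M}
    (hy : y ∉ maximalIdeal R • (⊤ : Submodule R M)) :
    ∃ p : M →ₗ[R] ResidueField R, p y = 1 := by
  let : Field (R ⧸ maximalIdeal R) := Ideal.Quotient.field _
  have hne : (Submodule.Quotient.mk y : M ⧸ maximalIdeal R • (⊤ : Submodule R M)) ≠ 0 := by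
    rwa [Ne, Submodule.Quotient.mk_eq_zero]
  obtain ⟨f, hf⟩ := LinearMap.exists_leftInverse_of_injective
    (LinearMap.toSpanSingleton (R ⧸ maximalIdeal R) _ _)
    (LinearMap.ker_toSpanSingleton (R ⧸ maximalIdeal R) hne)
  refine ⟨(f.restrictScalars R) ∘ₗ Submodule.mkQ _, ?_⟩
  have h₁ : f (Submodule.Quotient.mk y) = 1 := by simpa using LinearMap.congr_fun hf 1
  exact h₁

/-- A Burch submodule `M` is contained in a submodule `M'` of `X` such that the quotient map
`M' → M' / M ≅ k` factors through `M`. -/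
lemma IsBurch.exists_factorization {X : Type u} [AddCommGroup X] [Module R X]
    {M : Submodule R X} (hM : IsBurch M) :
    ∃ (M' : Submodule R X) (i : M →ₗ[R] M') (ρ : M' →ₗ[R] M) (p : M →ₗ[R] ResidueField R),
      Function.Injective i ∧ Function.Exact i (p ∘ₗ ρ) ∧ Function.Surjective (p ∘ₗ ρ) := by
  have hM_le : M ≤ colonIn M (maximalIdeal R) := fun x hx r _ => M.smul_mem r hx
  have hnot : ¬ maximalIdeal R • colonIn M (maximalIdeal R) ≤ maximalIdeal R • M := fun hle =>
    hM (le_antisymm hle (Submodule.smul_mono le_rfl hM_le))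
  rw [Submodule.smul_le] at hnot
  push Not at hnot
  obtain ⟨r, hr, x, hx, hrx⟩ := hnot
  let y : M := ⟨r • x, hx r hr⟩
  have hy : y ∉ maximalIdeal R • (⊤ : Submodule R M) := fun hmem => hrx <| by
    have := Submodule.mem_map_of_mem (f := M.subtype) hmem
    rwa [Submodule.map_smul'', Submodule.map_subtype_top] at this
  obtain ⟨p, hp⟩ := exists_linearMap_residueField_eq_one hy
  let M' : Submodule R X := M ⊔ R ∙ x
  have hρ : ∀ z : M', r • (z : X) ∈ M := fun z => by
    obtain ⟨m, hm, w, hw, hz⟩ := Submodule.mem_sup.1 z.2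
    obtain ⟨a, rfl⟩ := Submodule.mem_span_singleton.1 hw
    rw [← hz, smul_add, smul_comm]
    exact M.add_mem (M.smul_mem r hm) (M.smul_mem a (hx r hr))
  let ρ : M' →ₗ[R] M := (r • M'.subtype).codRestrict M hρ
  have hkill : ∀ z : ResidueField R, r • z = 0 := fun z => by
    rw [Algebra.smul_def]
    exact mul_eq_zero_of_left ((residue_eq_zero_iff r).2 hr) z
  -- `p ∘ ρ` reads off the coefficient of `x` modulo `𝔪`: the part in `M` dies because `r` kills
  -- `k`.
  have hval : ∀ (a : R) (m : M) (z : M'), (m : X) + a • x = z →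
      p (ρ z) = residue R a := fun a m z hz => by
    have : ρ z = r • m + a • y := Subtype.ext <| by
      change r • (z : X) = r • (m : X) + a • r • x
      rw [← hz, smul_add, smul_comm r a]
    rw [this, map_add, map_smul, map_smul, hkill, hp, zero_add, Algebra.smul_def, mul_one]
    rfl
  refine ⟨M', Submodule.inclusion le_sup_left, ρ, p, Submodule.inclusion_injective _, ?_, ?_⟩
  · intro z
    obtain ⟨m, hm, w, hw, hz⟩ := Submodule.mem_sup.1 z.2
    obtain ⟨a, rfl⟩ := Submodule.mem_span_singleton.1 hw
    rw [LinearMap.comp_apply, hval a ⟨m, hm⟩ z hz, residue_eq_zero_iff]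
    constructor
    · intro ha
      exact ⟨⟨z, hz ▸ M.add_mem hm (hx a ha)⟩, rfl⟩
    -- A unit coefficient would put `x` in `M`, hence `r x` in `𝔪 M`.
    · rintro ⟨m', rfl⟩
      by_contra ha
      have hu : IsUnit a := by simpa using ha
      have hax : a • x ∈ M := by
        have : a • x = m' - m := by rw [eq_sub_iff_add_eq', hz]; rfl
        rw [this]; exact M.sub_mem m'.2 hm
      have hxM : x ∈ M := by
        obtain ⟨u, rfl⟩ := hu
        simpa [smul_smul] using M.smul_mem (↑u⁻¹ : R) hax
      exact hrx (Submodule.smul_mem_smul hr hxM)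
  · intro c
    obtain ⟨a, rfl⟩ := residue_surjective c
    refine ⟨⟨a • x, Submodule.mem_sup_right
      (Submodule.smul_mem _ a (Submodule.mem_span_singleton_self x))⟩, ?_⟩
    exact hval a 0 _ (by simp)

end Burch

/-! ### The long exact sequence of `Tor` in the first variable, and finiteness. -/

section Tor

variable {R : Type u} [CommRing R]

/-- The short complex of complexes `S ⊗ P` obtained from a short complex `S` of modules. -/
noncomputable def tensorShortComplex (S : ShortComplex (ModuleCat.{u} R))
    (P : ChainComplex (ModuleCat.{u} R) ℕ) :
    ShortComplex (ChainComplex (ModuleCat.{u} R) ℕ) :=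
  ShortComplex.mk
    ((NatTrans.mapHomologicalComplex ((tensoringLeft (ModuleCat.{u} R)).map S.f) _).app P)
    ((NatTrans.mapHomologicalComplex ((tensoringLeft (ModuleCat.{u} R)).map S.g) _).app P)
    (by
      ext n : 1
      change S.f ▷ P.X n ≫ S.g ▷ P.X n = 0
      rw [← comp_whiskerRight, S.zero, MonoidalPreadditive.zero_whiskerRight])

/-- `Tor` is computed by resolving the second variable, so a short exact sequence in the first
variable only has to be tensored with the flat terms of one resolution. -/
lemma tensorShortComplex_shortExact {S : ShortComplex (ModuleCat.{u} R)} (hS : S.ShortExact)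
    (P : ChainComplex (ModuleCat.{u} R) ℕ) (hP : ∀ n, Module.Flat R (P.X n)) :
    (tensorShortComplex S P).ShortExact := by
  refine HomologicalComplex.shortExact_of_degreewise_shortExact _ fun n => ?_
  have := hP n
  exact hS.map_of_exact (tensorRight (P.X n))

lemma flat_complex_X {N : ModuleCat.{u} R} (P : ProjectiveResolution N) (n : ℕ) :
    Module.Flat R (P.complex.X n) :=
  have : Module.Projective R (P.complex.X n) :=
    (IsProjective.iff_projective _).2 (P.projective n)
  inferInstance

lemma ker_le_range_of_iso {A₁ A₂ A₃ B₁ B₂ B₃ : ModuleCat.{u} R} (g : A₂ ⟶ A₃) (δ : A₃ ⟶ A₁)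
    (w : g ≫ δ = 0) (h : (ShortComplex.mk g δ w).Exact) (e₁ : B₁ ≅ A₁) (e₂ : B₂ ≅ A₂)
    (e₃ : B₃ ≅ A₃) :
    LinearMap.ker (e₃.hom ≫ δ ≫ e₁.inv).hom ≤ LinearMap.range (e₂.hom ≫ g ≫ e₃.inv).hom := by
  intro y hy
  have hy' : δ (e₃.hom y) = 0 := by
    have h₁ : e₁.inv (δ (e₃.hom y)) = 0 := hy
    simpa using congrArg e₁.hom h₁
  obtain ⟨z, hz⟩ := (ShortComplex.moduleCat_exact_iff _).1 h _ hy'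
  replace hz : g z = e₃.hom y := hz
  exact ⟨e₂.inv z, by simp [hz]⟩

/-- The connecting map of the long exact sequence of `Tor` in the first variable, and exactness
at its source. -/
lemma exists_torδ {S : ShortComplex (ModuleCat.{u} R)} (hS : S.ShortExact)
    (N : ModuleCat.{u} R) (n : ℕ) :
    ∃ δ : ((Tor (ModuleCat.{u} R) (n + 1)).obj S.X₃).obj N ⟶
        ((Tor (ModuleCat.{u} R) n).obj S.X₁).obj N,
      LinearMap.ker δ.hom ≤
        LinearMap.range (((Tor (ModuleCat.{u} R) (n + 1)).map S.g).app N).hom := by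
  let P := projectiveResolution N
  have hSP := tensorShortComplex_shortExact hS P.complex (flat_complex_X P)
  let e (A : ModuleCat.{u} R) (m : ℕ) :=
    P.isoLeftDerivedObj ((tensoringLeft (ModuleCat.{u} R)).obj A) m
  refine ⟨(e S.X₃ (n + 1)).hom ≫ hSP.δ (n + 1) n rfl ≫ (e S.X₁ n).inv, ?_⟩
  have hmap : ((Tor (ModuleCat.{u} R) (n + 1)).map S.g).app N =
      (e S.X₂ (n + 1)).hom ≫ HomologicalComplex.homologyMap (tensorShortComplex S P.complex).g
        (n + 1) ≫ (e S.X₃ (n + 1)).inv :=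
    P.leftDerived_app_eq ((tensoringLeft (ModuleCat.{u} R)).map S.g) (n + 1)
  rw [hmap]
  exact ker_le_range_of_iso _ _ _ (hSP.homology_exact₃ (n + 1) n rfl) (e S.X₁ n)
    (e S.X₂ (n + 1)) (e S.X₃ (n + 1))

lemma isZero_tor_succ_of_flat (F N : ModuleCat.{u} R) [Module.Flat R F] (n : ℕ) :
    Limits.IsZero (((Tor (ModuleCat.{u} R) (n + 1)).obj F).obj N) := by
  let P := projectiveResolution N
  refine Limits.IsZero.of_iso ?_ (P.isoLeftDerivedObj
    ((tensoringLeft (ModuleCat.{u} R)).obj F) (n + 1))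
  refine (HomologicalComplex.exactAt_iff_isZero_homology
    ((((tensoringLeft (ModuleCat.{u} R)).obj F).mapHomologicalComplex _).obj P.complex) _).1 ?_
  exact Module.Flat.lTensor_shortComplex_exact F (P.complex.sc (n + 1))
    (P.complex_exactAt_succ n)

/-- Dimension shifting: for `0 → K → F → M → 0` with `F` finite free, `Tor_{n+1}(F, N) = 0`, so
`Tor_{n+1}(M, N)` embeds in `Tor_n(K, N)`. -/
instance finite_tor [IsNoetherianRing R] (M N : ModuleCat.{u} R) [Module.Finite R M]
    [Module.Finite R N] (n : ℕ) :
    Module.Finite R (((Tor (ModuleCat.{u} R) n).obj M).obj N) := by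
  induction n generalizing M with
  | zero =>
    have : Module.Finite R (((tensoringLeft (ModuleCat.{u} R)).obj M).obj N) :=
      inferInstanceAs (Module.Finite R (TensorProduct R M N))
    exact Module.Finite.equiv (((tensoringLeft (ModuleCat.{u} R)).obj M).leftDerivedZeroIsoSelf.app
      N).toLinearEquiv.symm
  | succ n ih =>
    obtain ⟨F, _, _, _, _, f, hf⟩ := Module.exists_finite_presentation R M
    let hS := LinearMap.shortExact_shortComplexKer hf
    have := ih (ModuleCat.of R (LinearMap.ker f))
    obtain ⟨δ, hδ⟩ := exists_torδ hS N n
    refine Module.Finite.of_injective δ.hom ?_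
    rw [← LinearMap.ker_eq_bot, eq_bot_iff]
    refine hδ.trans ?_
    have hz : ((Tor (ModuleCat.{u} R) (n + 1)).map f.shortComplexKer.g).app N = 0 :=
      (isZero_tor_succ_of_flat (ModuleCat.of R F) N n).eq_of_src _ _
    rw [hz]
    simp

end Tor

/-! ### Betti numbers bounded by the lengths of `Tor(k, N)`. -/

section Betti

variable {R : Type u} [CommRing R]

open TensorProduct in
/-- A functional on `V` vanishing on the kernel of `k ⊗ d` factors through `d`. -/
lemma exists_comp_eq_of_ker_baseChange_le {k : Type u} [Field k] [Algebra R k]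
    {V W : Type u} [AddCommGroup V] [Module R V] [AddCommGroup W] [Module R W]
    (d : V →ₗ[R] W) (f : V →ₗ[R] k)
    (h : ∀ x : k ⊗[R] V, d.lTensor k x = 0 → f.liftBaseChange k x = 0) :
    ∃ g : W →ₗ[R] k, g ∘ₗ d = f := by
  have hmem : f.liftBaseChange k ∈ LinearMap.range (d.baseChange k).dualMap := by
    rw [LinearMap.range_dualMap_eq_dualAnnihilator_ker, Submodule.mem_dualAnnihilator]
    exact fun x hx => h x hx
  obtain ⟨g, hg⟩ := hmem
  refine ⟨(g.restrictScalars R) ∘ₗ TensorProduct.mk R k W 1, LinearMap.ext fun v => ?_⟩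
  simpa using LinearMap.congr_fun hg (1 ⊗ₜ v)

variable [IsLocalRing R]

instance isSimpleModule_residueField : IsSimpleModule R (ResidueField R) :=
  isSimpleModule_iff_quot_maximal.2 ⟨_, maximalIdeal.isMaximal R, ⟨LinearEquiv.refl R _⟩⟩

/-- A map `T → k` kills `𝔪 T`, so it is determined by its values on lifts of a basis of `T / 𝔪 T`.
-/
lemma length_hom_residueField_le (T : Type u) [AddCommGroup T] [Module R T] [Module.Finite R T] :
    Module.length R (T →ₗ[R] ResidueField R) ≤ Module.length R T := by
  let : Field (R ⧸ maximalIdeal R) := Ideal.Quotient.field _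
  let Q := T ⧸ maximalIdeal R • (⊤ : Submodule R T)
  have : Module.Finite (R ⧸ maximalIdeal R) Q :=
    Module.Finite.of_restrictScalars_finite R (R ⧸ maximalIdeal R) Q
  let b := Module.finBasis (R ⧸ maximalIdeal R) Q
  choose t ht using fun i => Submodule.mkQ_surjective _ (b i)
  let ev : (T →ₗ[R] ResidueField R) →ₗ[R]
      (Fin (Module.finrank (R ⧸ maximalIdeal R) Q) → ResidueField R) :=
    LinearMap.pi fun i => LinearMap.applyₗ (t i)
  have hev : Function.Injective ev := by
    rw [← LinearMap.ker_eq_bot, eq_bot_iff]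
    intro f hf
    have hle : maximalIdeal R • (⊤ : Submodule R T) ≤ LinearMap.ker f :=
      Submodule.smul_le.2 fun r hr x _ => by
        rw [LinearMap.mem_ker, map_smul, Algebra.smul_def]
        exact mul_eq_zero_of_left ((residue_eq_zero_iff r).2 hr) _
    let g : Q →ₗ[R] R ⧸ maximalIdeal R := Submodule.liftQ _ f hle
    have hg : LinearMap.extendScalarsOfSurjective
        (Ideal.Quotient.mk_surjective (I := maximalIdeal R)) g = 0 := by
      refine b.ext fun i => ?_
      rw [← ht i]
      exact congrFun hf i
    refine LinearMap.ext fun x => ?_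
    exact LinearMap.congr_fun hg (Submodule.Quotient.mk x)
  calc Module.length R (T →ₗ[R] ResidueField R)
      ≤ Module.length R (Fin (Module.finrank (R ⧸ maximalIdeal R) Q) → ResidueField R) :=
        Module.length_le_of_injective ev hev
    _ = Module.finrank (R ⧸ maximalIdeal R) Q := by simp
    _ = Module.length R Q := by
        rw [Module.length_eq_of_surjective (R := R ⧸ maximalIdeal R) (S := R)
          Ideal.Quotient.mk_surjective]
        exact (Module.length_eq_finrank (R ⧸ maximalIdeal R) Q).symm
    _ ≤ Module.length R T := Module.length_le_of_surjective _ (Submodule.mkQ_surjective _)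

variable {N : ModuleCat.{u} R} (P : ProjectiveResolution N)

/-- The complex `k ⊗ P`. -/
noncomputable abbrev residueComplex : ChainComplex (ModuleCat.{u} R) ℕ :=
  (((tensoringLeft (ModuleCat.{u} R)).obj (ModuleCat.of R (ResidueField R))).mapHomologicalComplex
    _).obj P.complex

/-- The cocycles of degree `n` of the complex `Hom(P, k)`. -/
noncomputable abbrev residueCocycles (n : ℕ) :
    Submodule R (P.complex.X n →ₗ[R] ResidueField R) :=
  LinearMap.ker (LinearMap.lcomp R (ResidueField R) (P.complex.d (n + 1) n).hom)

/-- The class in `Ext^n(N, k)` of a cocycle, as a linear map. -/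
noncomputable def cocyclesToExt (n : ℕ) :
    residueCocycles P n →ₗ[R] Abelian.Ext N (ModuleCat.of R (ResidueField R)) n where
  toFun f := P.extMk (ModuleCat.ofHom f.1) (n + 1) rfl (ModuleCat.hom_ext f.2)
  map_add' f g := by
    rw [P.add_extMk]
    rfl
  map_smul' r f := by
    rw [RingHom.id_apply, Abelian.Ext.smul_eq_comp_mk₀, P.extMk_comp_mk₀]
    congr 1

lemma cocyclesToExt_surjective (n : ℕ) : Function.Surjective (cocyclesToExt P n) := fun x => by
  obtain ⟨f, hf, rfl⟩ := P.extMk_surjective x (n + 1) rfl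
  exact ⟨⟨f.hom, congrArg ModuleCat.Hom.hom hf⟩, rfl⟩

/-- The functional on `k ⊗ P_n` induced by a linear map `P_n → k`. -/
noncomputable def residueFunctional {n : ℕ} (f : P.complex.X n →ₗ[R] ResidueField R) :
    (residueComplex P).X n ⟶ ModuleCat.of R (ResidueField R) :=
  ModuleCat.ofHom ((f.liftBaseChange (ResidueField R)).restrictScalars R)

lemma d_comp_residueFunctional {n : ℕ} (f : residueCocycles P n) :
    (residueComplex P).d (n + 1) n ≫ residueFunctional P f.1 = 0 := by
  refine ModuleCat.hom_ext (TensorProduct.ext' fun a v => ?_)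
  have hf : f.1 ((P.complex.d (n + 1) n).hom v) = 0 := LinearMap.congr_fun f.2 v
  change a • f.1 ((P.complex.d (n + 1) n).hom v) = 0
  rw [hf, smul_zero]

/-- A cocycle of `Hom(P, k)` induces a functional on the homology of `k ⊗ P`. -/
noncomputable def cocyclesToDual (n : ℕ) :
    residueCocycles P n →ₗ[R] ((residueComplex P).homology n →ₗ[R] ResidueField R) where
  toFun f := ((residueComplex P).homologyι n ≫ (residueComplex P).descOpcycles
    (residueFunctional P f.1) (n + 1) (by simp) (d_comp_residueFunctional P f)).hom
  map_add' f g := by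
    rw [← ModuleCat.hom_add, ← Preadditive.comp_add]
    congr 2
    rw [← cancel_epi ((residueComplex P).pOpcycles n), Preadditive.comp_add,
      HomologicalComplex.p_descOpcycles, HomologicalComplex.p_descOpcycles,
      HomologicalComplex.p_descOpcycles]
    exact ModuleCat.hom_ext (TensorProduct.ext' fun a v => smul_add a (f.1 v) (g.1 v))
  map_smul' r f := by
    rw [RingHom.id_apply, ← ModuleCat.hom_smul, ← Linear.comp_smul]
    congr 2
    rw [← cancel_epi ((residueComplex P).pOpcycles n), Linear.comp_smul,
      HomologicalComplex.p_descOpcycles, HomologicalComplex.p_descOpcycles]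
    exact ModuleCat.hom_ext (TensorProduct.ext' fun a v => smul_comm a r (f.1 v))

/-- If `f` induces zero on homology, its extension to `k ⊗ P` vanishes on cycles, that is, on the
kernel of `k ⊗ d`. Over a field it then factors through `k ⊗ d`, so `f` is a coboundary. -/
lemma cocyclesToExt_eq_zero {n : ℕ} (f : residueCocycles P (n + 1))
    (hf : cocyclesToDual P (n + 1) f = 0) : cocyclesToExt P (n + 1) f = 0 := by
  have h₀ : (residueComplex P).homologyι (n + 1) ≫ (residueComplex P).descOpcycles
      (residueFunctional P f.1) (n + 2) (by simp) (d_comp_residueFunctional P f) = 0 :=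
    ModuleCat.hom_ext hf
  have h₁ : (residueComplex P).iCycles (n + 1) ≫ residueFunctional P f.1 = 0 := by
    have := congrArg (fun t => (residueComplex P).homologyπ (n + 1) ≫ t) h₀
    simpa using this
  have hex : (ShortComplex.mk ((residueComplex P).iCycles (n + 1))
      ((residueComplex P).d (n + 1) n) (HomologicalComplex.iCycles_d _ _ _)).Exact :=
    ShortComplex.exact_of_f_is_kernel _ ((residueComplex P).cyclesIsKernel (n + 1) n (by simp))
  obtain ⟨g, hg⟩ := exists_comp_eq_of_ker_baseChange_le (P.complex.d (n + 1) n).hom f.1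
    fun x hx => by
      obtain ⟨c, hc⟩ := (ShortComplex.moduleCat_exact_iff _).1 hex x hx
      have := LinearMap.congr_fun (congrArg ModuleCat.Hom.hom h₁) c
      rw [← hc]
      exact this
  have hf' : P.complex.d (n + 2) (n + 1) ≫ ModuleCat.ofHom f.1 = 0 := ModuleCat.hom_ext f.2
  exact (P.extMk_eq_zero_iff _ _ rfl hf' n rfl).2 ⟨ModuleCat.ofHom g, ModuleCat.hom_ext hg⟩

/-- This is the half that is needed of the duality `Ext^{n+1}(N, k) ≅ Hom(Tor_{n+1}(k, N), k)`. -/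
lemma length_ext_residueField_le (n : ℕ)
    [Module.Finite R ((residueComplex P).homology (n + 1))] :
    Module.length R (Abelian.Ext N (ModuleCat.of R (ResidueField R)) (n + 1)) ≤
      Module.length R ((residueComplex P).homology (n + 1)) :=
  (length_le_of_ker_le (R := R) (Z := residueCocycles P (n + 1))
    (E := Abelian.Ext N (ModuleCat.of R (ResidueField R)) (n + 1))
    (H := (residueComplex P).homology (n + 1) →ₗ[R] ResidueField R)
    (cocyclesToExt P (n + 1)) (cocyclesToDual P (n + 1))
    (cocyclesToExt_surjective P (n + 1)) (cocyclesToExt_eq_zero P)).trans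
    (length_hom_residueField_le (R := R) ((residueComplex P).homology (n + 1)))

lemma betti_le_length_tor [IsNoetherianRing R] (N : Type u) [AddCommGroup N] [Module R N]
    [Module.Finite R N] (n : ℕ) :
    (betti R N (n + 1) : ℕ∞) ≤ Module.length R (TorMod R (n + 1) (ResidueField R) N) := by
  let P := projectiveResolution (ModuleCat.of R N)
  have : Module.Finite R (ResidueField R) := Module.Finite.of_surjective
    (Algebra.linearMap R (ResidueField R)) residue_surjective
  let e : TorMod R (n + 1) (ResidueField R) N ≃ₗ[R] (residueComplex P).homology (n + 1) :=
    (P.isoLeftDerivedObj ((tensoringLeft (ModuleCat.{u} R)).obj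
      (ModuleCat.of R (ResidueField R))) (n + 1)).toLinearEquiv
  have hfin : Module.Finite R (TorMod R (n + 1) (ResidueField R) N) := finite_tor _ _ _
  have : Module.Finite R ((residueComplex P).homology (n + 1)) :=
    @Module.Finite.equiv _ _ _ _ _ _ _ _ hfin e
  exact (finrank_le_length (ext_residueField_torsion R (n + 1) N)).trans
    ((length_ext_residueField_le P n).trans e.symm.length_eq.le)

end Betti

/-! ### The length inequalities and the theorem. -/

section Main

variable {R : Type u} [CommRing R]

/-- If the quotient map of a short exact sequence `0 → A → B → C → 0` factors through `A`, then
`length Tor_{n+1}(C, N) ≤ length Tor_{n+1}(A, N) + length Tor_n(A, N)`. -/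
lemma length_tor_le_of_factorization {A B C : ModuleCat.{u} R} (N : ModuleCat.{u} R)
    {i : A ⟶ B} {ρ : B ⟶ A} {p : A ⟶ C} (w : i ≫ ρ ≫ p = 0)
    (hS : (ShortComplex.mk i (ρ ≫ p) w).ShortExact) (n : ℕ) :
    Module.length R (((Tor (ModuleCat.{u} R) (n + 1)).obj C).obj N) ≤
      Module.length R (((Tor (ModuleCat.{u} R) (n + 1)).obj A).obj N) +
        Module.length R (((Tor (ModuleCat.{u} R) n).obj A).obj N) := by
  obtain ⟨δ, hδ⟩ := exists_torδ hS N n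
  refine length_le_add_of_ker_le_range (((Tor (ModuleCat.{u} R) (n + 1)).map p).app N).hom
    δ.hom (hδ.trans ?_)
  rintro _ ⟨x, rfl⟩
  refine ⟨((Tor (ModuleCat.{u} R) (n + 1)).map ρ).app N x, ?_⟩
  have : ((Tor (ModuleCat.{u} R) (n + 1)).map (ρ ≫ p)).app N =
      ((Tor (ModuleCat.{u} R) (n + 1)).map ρ).app N ≫
        ((Tor (ModuleCat.{u} R) (n + 1)).map p).app N := by
    rw [Functor.map_comp, NatTrans.comp_app]
  exact (LinearMap.congr_fun (congrArg ModuleCat.Hom.hom this) x).symm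

/-- If the quotient map of a short exact sequence `0 → A → B → C → 0` factors through `A`, then
`length Ext^{n+1}(C, N) ≤ length Ext^n(A, N) + length Ext^{n+1}(A, N)`. -/
lemma length_ext_le_of_factorization {A B C : ModuleCat.{u} R} (N : ModuleCat.{u} R)
    {i : A ⟶ B} {ρ : B ⟶ A} {p : A ⟶ C} (w : i ≫ ρ ≫ p = 0)
    (hS : (ShortComplex.mk i (ρ ≫ p) w).ShortExact) (n : ℕ) :
    Module.length R (Abelian.Ext C N (n + 1)) ≤
      Module.length R (Abelian.Ext A N n) + Module.length R (Abelian.Ext A N (n + 1)) := by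
  -- A class killed by pullback along `p` is killed along `ρ ≫ p`, so it comes from `Ext^n(A, N)` by
  -- the connecting map.
  refine length_le_add_of_ker_le_range
    (hS.extClass.precompOfLinear R N (add_comm 1 n))
    ((Abelian.Ext.mk₀ p).precompOfLinear R N (zero_add (n + 1))) fun x hx => ?_
  have hx' : (Abelian.Ext.mk₀ p).comp x (zero_add (n + 1)) = 0 := hx
  refine Abelian.Ext.contravariant_sequence_exact₃ hS N x ?_ (add_comm 1 n)
  rw [← Abelian.Ext.mk₀_comp_mk₀_assoc, hx', Abelian.Ext.comp_zero]

variable [IsLocalRing R]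

lemma dominatedByConsecutive_numGen [IsNoetherianRing R] (T : ℕ → Type u)
    [∀ n, AddCommGroup (T n)] [∀ n, Module R (T n)] [∀ n, Module.Finite R (T n)] {h n₀ : ℕ}
    (hT : ∀ n ≥ n₀, maximalIdeal R ^ h • (⊤ : Submodule R (T n)) = ⊥) {b : ℕ → ℕ}
    (hb : ∀ n, (b (n + 1) : ℕ∞) ≤ Module.length R (T (n + 1)) + Module.length R (T n)) :
    DominatedByConsecutive (fun n => (b n : ℝ)) fun n => (numGen R (T n) : ℝ) := by
  obtain ⟨c, hc⟩ := ENat.ne_top_iff_exists.1 (length_quotient_maximalIdeal_pow_ne_top (R := R) h)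
  -- `c` is the length of `R ⧸ 𝔪 ^ h`; adding `1` keeps the constant positive when `h = 0`.
  refine ⟨c + 1, by positivity, eventually_atTop.2 ⟨n₀, fun n hn => ?_⟩⟩
  have h₁ := length_le_numGen_mul _ _ (hT n hn)
  have h₂ := length_le_numGen_mul _ _ (hT (n + 1) (by omega))
  rw [← hc] at h₁ h₂
  have h₃ : b (n + 1) ≤ numGen R (T (n + 1)) * c + numGen R (T n) * c := by
    exact_mod_cast (hb n).trans (add_le_add h₂ h₁)
  have h₄ : (b (n + 1) : ℝ) ≤ numGen R (T (n + 1)) * c + numGen R (T n) * c := by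
    exact_mod_cast h₃
  have h₅ : (0 : ℝ) ≤ numGen R (T (n + 1)) + numGen R (T n) := by positivity
  linarith

variable {X : Type u} [AddCommGroup X] [Module R X] {M : Submodule R X}

lemma IsBurch.exists_shortExact (hM : IsBurch M) :
    ∃ (B : ModuleCat.{u} R) (i : ModuleCat.of R M ⟶ B) (ρ : B ⟶ ModuleCat.of R M)
      (p : ModuleCat.of R M ⟶ ModuleCat.of R (ResidueField R)) (w : i ≫ ρ ≫ p = 0),
      (ShortComplex.mk i (ρ ≫ p) w).ShortExact := by
  obtain ⟨M', i, ρ, p, hi, hex, hsurj⟩ := hM.exists_factorization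
  have w : ModuleCat.ofHom i ≫ ModuleCat.ofHom ρ ≫ ModuleCat.ofHom p = 0 :=
    ModuleCat.hom_ext hex.linearMap_comp_eq_zero
  exact ⟨ModuleCat.of R M', ModuleCat.ofHom i, ModuleCat.ofHom ρ, ModuleCat.ofHom p, w,
    ModuleCat.shortComplex_shortExact _ hex hi hsurj⟩

/-- The Betti numbers of `N` are bounded by two consecutive lengths of `Tor(M, N)` if `M` is a
Burch submodule. -/
lemma IsBurch.betti_le [IsNoetherianRing R] {N : Type u} [AddCommGroup N] [Module R N]
    [Module.Finite R N] (hM : IsBurch M) (n : ℕ) :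
    (betti R N (n + 1) : ℕ∞) ≤
      Module.length R (TorMod R (n + 1) M N) + Module.length R (TorMod R n M N) := by
  obtain ⟨B, i, ρ, p, w, hS⟩ := hM.exists_shortExact
  exact (betti_le_length_tor N n).trans (length_tor_le_of_factorization (ModuleCat.of R N) w hS n)

/-- The Bass numbers of `N` are bounded by two consecutive lengths of `Ext(M, N)` if `M` is a
Burch submodule. -/
lemma IsBurch.bass_le {N : Type u} [AddCommGroup N] [Module R N] (hM : IsBurch M) (n : ℕ) :
    (bass R N (n + 1) : ℕ∞) ≤
      Module.length R (ExtMod R (n + 1) M N) + Module.length R (ExtMod R n M N) := by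
  obtain ⟨B, i, ρ, p, w, hS⟩ := hM.exists_shortExact
  have h₁ : (bass R N (n + 1) : ℕ∞) ≤ Module.length R (ExtMod R (n + 1) (ResidueField R) N) :=
    finrank_le_length (ext_from_residueField_torsion R (n + 1) N)
  have h₂ : Module.length R (ExtMod R (n + 1) (ResidueField R) N) ≤
      Module.length R (ExtMod R n M N) + Module.length R (ExtMod R (n + 1) M N) :=
    length_ext_le_of_factorization (ModuleCat.of R N) w hS n
  exact (h₁.trans h₂).trans (add_comm _ _).le

end Main

end BurchGrowth

/-- Both parts follow from the bounds `IsBurch.betti_le` and `IsBurch.bass_le`, which hold for Burch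
submodules of an arbitrary module `X`; the hypothesis `hX` is not used. -/
theorem mainTheorem3 {R : Type u} [CommRing R] [IsLocalRing R] [IsNoetherianRing R]
    {X N : Type u} [AddCommGroup X] [Module R X] [Module.Finite R X]
    [AddCommGroup N] [Module R N] [Module.Finite R N]
    (M : Submodule R X) (hM : IsBurch M)
    (hX : gDim R X < ⊤ ∨ IsTorsionless R X) :
    ((∃ h : ℕ, 0 < h ∧ ∃ n₀ : ℕ, ∀ n ≥ n₀,
        maximalIdeal R ^ h • (⊤ : Submodule R (TorMod R n M N)) = ⊥) →
      cx R N ≤ tcx R M N ∧ curv R N ≤ tcurv R M N) ∧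
    ((∃ h : ℕ, 0 < h ∧ ∃ n₀ : ℕ, ∀ n ≥ n₀,
        maximalIdeal R ^ h • (⊤ : Submodule R (ExtMod R n M N)) = ⊥) →
      injcx R N ≤ cxPair R M N ∧ injcurv R N ≤ curvPair R M N) := by
  constructor
  · rintro ⟨h, -, n₀, hT⟩
    have (n : ℕ) : Module.Finite R (TorMod R n M N) := finite_tor _ _ n
    have hdom := dominatedByConsecutive_numGen (fun n => TorMod R n M N) hT
      (b := betti R N) hM.betti_le
    exact ⟨cxSeq_le_of_dominated hdom,
      curvSeq_le_of_dominated (fun _ => Nat.cast_nonneg _) (fun _ => Nat.cast_nonneg _) hdom⟩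
  · rintro ⟨h, -, n₀, hT⟩
    have (n : ℕ) : Module.Finite R (ExtMod R n M N) := ModuleCat.finite_ext R _ _ n
    have hdom := dominatedByConsecutive_numGen (fun n => ExtMod R n M N) hT
      (b := bass R N) hM.bass_le
    exact ⟨cxSeq_le_of_dominated hdom,
      curvSeq_le_of_dominated (fun _ => Nat.cast_nonneg _) (fun _ => Nat.cast_nonneg _) hdom⟩
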